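/- Let $\mathcal C$ be a category with finite colimits and let $(\mathcal E,\mathcal M)$ be a factorisation system on $\mathcal C$ such that $\mathcal M$ is stable under pushout. Let $\mathcal C;\mathcal M^{\mathrm{op}}$ be the monoidal category whose objects are those of $\mathcal C$, whose morphisms $X\to Y$ are isomorphism classes of cospans $X\xrightarrow{c}N\xleftarrow{m}Y$ with $m\in\mathcal M$, composed by pushout, and whose monoidal structure is given by the coproduct $+$ of $\mathcal C$. Let $(F,\varphi)\colon(\mathcal C;\mathcal M^{\mathrm{op}},+)\to(\mathrm{Set},\times)$ be a lax monoidal functor; write also $F$ for its restriction along $\mathcal C\to\mathcal C;\mathcal M^{\mathrm{op}}$, $f\mapsto(\xrightarrow{f}\xleftarrow{1})$, and for $m\colon K\to N$ in $\mathcal M$ let $m^{\mathrm{op}}\colon N\to K$ be the morphism $N\xrightarrow{1}N\xleftarrow{m}K$ of $\mathcal C;\mathcal M^{\mathrm{op}}$. An $F$-decorated cospan $X\to Y$ is a cospan $X\xrightarrow{i}N\xleftarrow{o}Y$ in $\mathcal C$ with an element $s\in FN$; an isomorphism of such is an isomorphism $n$ of cospans with $F(n)(s)=s'$. The composite of $(X\to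 N\leftarrow Y,s)$ and $(Y\to M\leftarrow Z,t)$ is the pushout cospan $X\to N+_YM\leftarrow Z$ decorated by $F[j_N,j_M](\varphi_{N,M}(s,t))$, where $j_N,j_M$ are the pushout maps; the identity on $X$ is the identity cospan decorated by $F(!)(\varphi_1)$, where $!\colon\varnothing\to X$. The jointly $\mathcal E$-part of $(X\xrightarrow{i}N\xleftarrow{o}Y,s)$ is $X\xrightarrow{e\iota_X}\overline N\xleftarrow{e\iota_Y}Y$ with the restricted decoration $F(m^{\mathrm{op}})(s)\in F\overline N$, where $X+Y\xrightarrow{e}\overline N\xrightarrow{m}N$ is an $(\mathcal E,\mathcal M)$-factorisation of $[i,o]$. An $F$-decorated corelation is an $F$-decorated cospan with $[i,o]\in\mathcal E$; composites and identities of decorated corelations are the jointly $\mathcal E$-parts, with restricted decorations, of the composites and identities as decorated cospans. Then: 1. the objects of $\mathcal C$ and the isomorphism classes of $F$-decorated corelations form a category $F\mathrm{Corel}$; 2. the objects of $\mathcal C$ and the isomorphism classes of $F$-decorated cospans form a category $F\mathrm{Cospan}$; 3. there is a functor $F\mathrm{Cospan}\to F\mathrm{Corel}$ which is the identity on objects and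 which sends the class of each decorated cospan $(X\to N\leftarrow Y,s)$ to the class of its jointly $\mathcal E$-part decorated by $F(m^{\mathrm{op}})(s)$, for every choice of $(\mathcal E,\mathcal M)$-factorisation $m\circ e$ of $[i,o]$. -/

import Mathlib

open CategoryTheory CategoryTheory.Limits

universe w v u

namespace DecoratedCorelations

noncomputable section

/-! ### Factorisation systems -/

/-- A factorisation system `(E, M)` in `C`: two subcategories containing all isomorphisms, such
that every morphism factors as an `E`-morphism followed by an `M`-morphism, and such that every
commutative square between two factored morphisms has a unique filler between the middle
objects. -/
class IsFactorizationSystem {C : Type u} [Category.{v} C] (E M : MorphismProperty C) : Prop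
    extends MorphismProperty.HasFactorization E M where
  left_isMultiplicative : E.IsMultiplicative
  right_isMultiplicative : M.IsMultiplicative
  isomorphisms_le_left : MorphismProperty.isomorphisms C ≤ E
  isomorphisms_le_right : MorphismProperty.isomorphisms C ≤ M
  existsUnique_filler {A K B A' K' B' : C} (e : A ⟶ K) (m : K ⟶ B) (e' : A' ⟶ K') (m' : K' ⟶ B')
    (u : A ⟶ A') (v : B ⟶ B') (he : E e) (hm : M m) (he' : E e') (hm' : M m')
    (sq : u ≫ e' ≫ m' = (e ≫ m) ≫ v) : ∃! s : K ⟶ K', e ≫ s = u ≫ e' ∧ m ≫ v = s ≫ m'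

/-! ### The monoidal category `C ; Mᵒᵖ` -/

/-- Cospans `X ⟶ N ⟵ Y` whose right leg lies in `M`. -/
structure MCospan {C : Type u} [Category.{v} C] (M : MorphismProperty C) (X Y : C) where
  apex : C
  left : X ⟶ apex
  right : Y ⟶ apex
  mem : M right

/-- Isomorphism of cospans. -/
instance MCospan.setoid {C : Type u} [Category.{v} C] (M : MorphismProperty C) (X Y : C) :
    Setoid (MCospan M X Y) where
  r a b := ∃ n : a.apex ≅ b.apex, a.left ≫ n.hom = b.left ∧ a.right ≫ n.hom = b.right
  iseqv :=
    { refl := fun a => ⟨Iso.refl _, by simp, by simp⟩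
      symm := by
        rintro a b ⟨n, h₁, h₂⟩
        exact ⟨n.symm, by simp [← h₁], by simp [← h₂]⟩
      trans := by
        rintro a b c ⟨n, h₁, h₂⟩ ⟨k, h₃, h₄⟩
        exact ⟨n ≪≫ k, by simp [← h₃, ← h₁], by simp [← h₄, ← h₂]⟩ }

/-- The composite of two cospans in `C ; Mᵒᵖ`, formed with a given pushout square. -/
def MCospan.compOfIsPushout {C : Type u} [Category.{v} C] {M : MorphismProperty C}
    [M.IsMultiplicative] [M.IsStableUnderCobaseChange] {X Y Z : C} (a : MCospan M X Y)
    (b : MCospan M Y Z) {P : C} {i : a.apex ⟶ P} {j : b.apex ⟶ P}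
    (h : IsPushout a.right b.left i j) : MCospan M X Z where
  apex := P
  left := a.left ≫ i
  right := b.right ≫ j
  mem := M.comp_mem _ _ b.mem (MorphismProperty.of_isPushout h.flip a.mem)

theorem MCospan.compOfIsPushout_equiv {C : Type u} [Category.{v} C] {M : MorphismProperty C}
    [M.IsMultiplicative] [M.IsStableUnderCobaseChange] {X Y Z : C} {a a' : MCospan M X Y}
    {b b' : MCospan M Y Z} (ha : a ≈ a') (hb : b ≈ b') {P P' : C}
    {i : a.apex ⟶ P} {j : b.apex ⟶ P} (h : IsPushout a.right b.left i j)
    {i' : a'.apex ⟶ P'} {j' : b'.apex ⟶ P'} (h' : IsPushout a'.right b'.left i' j') :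
    a.compOfIsPushout b h ≈ a'.compOfIsPushout b' h' := by
  obtain ⟨n, hn₁, hn₂⟩ := ha
  obtain ⟨k, hk₁, hk₂⟩ := hb
  have h'' : IsPushout a.right b.left (n.hom ≫ i') (k.hom ≫ j') :=
    h'.of_iso (Iso.refl _) n.symm k.symm (Iso.refl _) (by simp [← hn₂]) (by simp [← hk₁])
      (by simp) (by simp)
  refine ⟨h.isoIsPushout _ _ h'', ?_, ?_⟩
  · simp [compOfIsPushout, ← hn₁]
  · simp [compOfIsPushout, ← hk₂]

/-! #### The category `C ; Mᵒᵖ` -/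

/-- The category `C ; Mᵒᵖ` has the same objects as `C`. -/
structure AdjoinOp {C : Type u} [Category.{v} C] (M : MorphismProperty C) where
  of ::
  as : C

/-- Morphisms of `C ; Mᵒᵖ` are isomorphism classes of cospans `⟶ ⟵` with right leg in `M`. -/
instance {C : Type u} [Category.{v} C] {M : MorphismProperty C} : Quiver (AdjoinOp M) where
  Hom X Y := Quotient (MCospan.setoid M X.as Y.as)

namespace AdjoinOp

section

variable {C : Type u} [Category.{v} C] {M : MorphismProperty C}

/-- The class of a cospan. -/
def mk {X Y : AdjoinOp M} (a : MCospan M X.as Y.as) : X ⟶ Y := Quotient.mk _ a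

theorem ind {X Y : AdjoinOp M} {p : (X ⟶ Y) → Prop} (h : ∀ a, p (mk a)) (f : X ⟶ Y) : p f :=
  Quotient.ind h f

theorem mk_eq {X Y : AdjoinOp M} {a b : MCospan M X.as Y.as} (n : a.apex ≅ b.apex)
    (h₁ : a.left ≫ n.hom = b.left) (h₂ : a.right ≫ n.hom = b.right) :
    (mk a : X ⟶ Y) = mk b :=
  Quotient.sound ⟨n, h₁, h₂⟩

end

section

variable {C : Type u} [Category.{v} C] [HasFiniteColimits C] {M : MorphismProperty C}
  [M.IsMultiplicative] [M.IsStableUnderCobaseChange]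

/-- Composition in `C ; Mᵒᵖ` is by pushout. -/
instance : CategoryStruct (AdjoinOp M) where
  id X := mk ⟨X.as, 𝟙 _, 𝟙 _, M.id_mem _⟩
  comp f g := Quotient.map₂
    (fun a b => a.compOfIsPushout b (IsPushout.of_hasPushout a.right b.left))
    (fun _ _ ha _ _ hb => MCospan.compOfIsPushout_equiv ha hb _ _) f g

theorem id_eq (X : AdjoinOp M) : 𝟙 X = mk ⟨X.as, 𝟙 _, 𝟙 _, M.id_mem _⟩ := rfl

/-- Composites may be computed with any pushout square. -/
theorem mk_comp_mk {X Y Z : AdjoinOp M} (a : MCospan M X.as Y.as) (b : MCospan M Y.as Z.as)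
    {P : C} {i : a.apex ⟶ P} {j : b.apex ⟶ P} (h : IsPushout a.right b.left i j) :
    (mk a : X ⟶ Y) ≫ (mk b : Y ⟶ Z) = mk (a.compOfIsPushout b h) :=
  Quotient.sound (MCospan.compOfIsPushout_equiv (Setoid.refl _) (Setoid.refl _) _ _)

instance : Category (AdjoinOp M) where
  id_comp {X Y} f := by
    induction f using ind with | h a
    refine (mk_comp_mk _ a (IsPushout.of_id_fst (f := a.left))).trans ?_
    exact mk_eq (Iso.refl _) (by simp [MCospan.compOfIsPushout])
      (by simp [MCospan.compOfIsPushout])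
  comp_id {X Y} f := by
    induction f using ind with | h a
    refine (mk_comp_mk a _ (IsPushout.of_id_snd (f := a.right))).trans ?_
    exact mk_eq (Iso.refl _) (by simp [MCospan.compOfIsPushout])
      (by simp [MCospan.compOfIsPushout])
  assoc {W X Y Z} f g h := by
    induction f using ind with | h a
    induction g using ind with | h b
    induction h using ind with | h c
    have h₁ := IsPushout.of_hasPushout a.right b.left
    have h₂ := IsPushout.of_hasPushout b.right c.left
    have h₃ := IsPushout.of_hasPushout (pushout.inr a.right b.left) (pushout.inl b.right c.left)
    rw [mk_comp_mk a b h₁, mk_comp_mk b c h₂,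
      mk_comp_mk (a.compOfIsPushout b h₁) c (h₂.paste_horiz h₃),
      mk_comp_mk a (b.compOfIsPushout c h₂) (h₁.paste_vert h₃)]
    exact mk_eq (Iso.refl _) (by simp [MCospan.compOfIsPushout])
      (by simp [MCospan.compOfIsPushout])

variable (M) in
/-- The inclusion of `C` in `C ; Mᵒᵖ`: a morphism `f` is sent to the cospan `⟶ ⟵` with legs
`f` and the identity. -/
def incl : C ⥤ AdjoinOp M where
  obj X := of X
  map {_ Y} f := mk ⟨Y, f, 𝟙 Y, M.id_mem Y⟩
  map_id _ := rfl
  map_comp {X Y Z} f g := by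
    rw [mk_comp_mk (X := of X) (Y := of Y) (Z := of Z) _ _ (IsPushout.of_id_fst (f := g))]
    exact mk_eq (Iso.refl _) (by simp [MCospan.compOfIsPushout])
      (by simp [MCospan.compOfIsPushout])

/-- The morphism `mᵒᵖ : N ⟶ K` of `C ; Mᵒᵖ` given by a morphism `m : K ⟶ N` in `M`: the
cospan `N ⟶ N ⟵ K` with legs the identity and `m`. -/
def opHom {K N : C} (m : K ⟶ N) (hm : M m) : (of N : AdjoinOp M) ⟶ of K :=
  mk ⟨N, 𝟙 N, m, hm⟩

theorem incl_map_comp_mk {X Y Z : C} (f : X ⟶ Y) (a : MCospan M Y Z) :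
    (incl M).map f ≫ (mk a : of Y ⟶ of Z) = mk ⟨a.apex, f ≫ a.left, a.right, a.mem⟩ := by
  refine (mk_comp_mk (X := of X) (Y := of Y) (Z := of Z) _ a
    (IsPushout.of_id_fst (f := a.left))).trans ?_
  exact mk_eq (Iso.refl _) (by simp [MCospan.compOfIsPushout])
      (by simp [MCospan.compOfIsPushout])

theorem mk_comp_incl_map {X Y Z : C} (a : MCospan M X Y) (f : Y ⟶ Z) {P : C}
    (i : a.apex ⟶ P) (j : Z ⟶ P) (h : IsPushout a.right f i j) :
    (mk a : of X ⟶ of Y) ≫ (incl M).map f =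
      mk ⟨P, a.left ≫ i, j, MorphismProperty.of_isPushout h.flip a.mem⟩ := by
  refine (mk_comp_mk (X := of X) (Y := of Y) (Z := of Z) a _ h).trans ?_
  exact mk_eq (Iso.refl _) (by simp [MCospan.compOfIsPushout])
      (by simp [MCospan.compOfIsPushout])

end

end AdjoinOp

/-! #### The monoidal structure given by the coproduct -/

section

theorem isPushout_of_exists {C : Type u} [Category.{v} C] {A B A' P : C} {f : A ⟶ B} {g : A ⟶ A'}
    {i : B ⟶ P} {j : A' ⟶ P} (w : f ≫ i = g ≫ j)
    (h : ∀ (T : C) (x : B ⟶ T) (y : A' ⟶ T), f ≫ x = g ≫ y → ∃ d : P ⟶ T, i ≫ d = x ∧ j ≫ d = y)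
    (hom_ext : ∀ (T : C) (k l : P ⟶ T), i ≫ k = i ≫ l → j ≫ k = j ≫ l → k = l) :
    IsPushout f g i j :=
  ⟨⟨w⟩, ⟨PushoutCocone.IsColimit.mk w
    (fun s => (h s.pt s.inl s.inr s.condition).choose)
    (fun s => (h s.pt s.inl s.inr s.condition).choose_spec.1)
    (fun s => (h s.pt s.inl s.inr s.condition).choose_spec.2)
    (fun s _ h₁ h₂ => hom_ext _ _ _
      (h₁.trans (h s.pt s.inl s.inr s.condition).choose_spec.1.symm)
      (h₂.trans (h s.pt s.inl s.inr s.condition).choose_spec.2.symm))⟩⟩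

variable {C : Type u} [Category.{v} C] [HasFiniteColimits C]

theorem isPushout_coprodMap {A B A' P D E D' Q : C} {f : A ⟶ B} {g : A ⟶ A'} {i : B ⟶ P}
    {j : A' ⟶ P} (h : IsPushout f g i j) {f' : D ⟶ E} {g' : D ⟶ D'} {i' : E ⟶ Q}
    {j' : D' ⟶ Q} (h' : IsPushout f' g' i' j') :
    IsPushout (coprod.map f f') (coprod.map g g') (coprod.map i i') (coprod.map j j') := by
  refine isPushout_of_exists (by simp [h.w, h'.w]) (fun T x y e => ?_) (fun T k l h₁ h₂ => ?_)
  · have e₁ := coprod.inl ≫= e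
    have e₂ := coprod.inr ≫= e
    simp only [coprod.inl_map_assoc, coprod.inr_map_assoc] at e₁ e₂
    refine ⟨coprod.desc (h.desc _ _ e₁) (h'.desc _ _ e₂), ?_, ?_⟩
    · refine coprod.hom_ext ?_ ?_
      · rw [coprod.inl_map_assoc, coprod.inl_desc, IsPushout.inl_desc]
      · rw [coprod.inr_map_assoc, coprod.inr_desc, IsPushout.inl_desc]
    · refine coprod.hom_ext ?_ ?_
      · rw [coprod.inl_map_assoc, coprod.inl_desc, IsPushout.inr_desc]
      · rw [coprod.inr_map_assoc, coprod.inr_desc, IsPushout.inr_desc]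
  · have a₁ := coprod.inl ≫= h₁
    have a₂ := coprod.inr ≫= h₁
    have b₁ := coprod.inl ≫= h₂
    have b₂ := coprod.inr ≫= h₂
    simp only [coprod.inl_map_assoc, coprod.inr_map_assoc] at a₁ a₂ b₁ b₂
    ext
    · exact h.hom_ext a₁ b₁
    · exact h'.hom_ext a₂ b₂

variable {M : MorphismProperty C} [M.IsMultiplicative] [M.IsStableUnderCobaseChange]

/-- `M` is closed under coproducts of morphisms. -/
theorem coprodMap_mem {A B A' B' : C} {f : A ⟶ B} {g : A' ⟶ B'} (hf : M f) (hg : M g) :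
    M (coprod.map f g) := by
  have h₁ : M (coprod.map f (𝟙 A')) := by
    refine MorphismProperty.of_isPushout (f := f) (g := coprod.inl) (g' := coprod.inl) ?_ hf
    exact IsPushout.of_coprod_inl_with_id f A'
  have h₂ : M (coprod.map (𝟙 B) g) := by
    refine MorphismProperty.of_isPushout (f := g) (g := coprod.inr) (g' := coprod.inr) ?_ hg
    refine isPushout_of_exists (by simp) (fun T x y e => ?_) (fun T k l h₁ h₂ => ?_)
    · refine ⟨coprod.desc (coprod.inl ≫ x) y, coprod.hom_ext ?_ ?_, coprod.inr_desc _ _⟩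
      · rw [coprod.inl_map_assoc, Category.id_comp, coprod.inl_desc]
      · rw [coprod.inr_map_assoc, coprod.inr_desc, e]
    · have a₁ := coprod.inl ≫= h₁
      simp only [coprod.inl_map_assoc, Category.id_comp] at a₁
      ext
      · exact a₁
      · exact h₂
  have : coprod.map f g = coprod.map f (𝟙 A') ≫ coprod.map (𝟙 B) g := by simp
  exact this ▸ M.comp_mem _ _ h₁ h₂

/-- The coproduct of two cospans. -/
def MCospan.sum {X Y X' Y' : C} (a : MCospan M X Y) (b : MCospan M X' Y') :
    MCospan M (X ⨿ X') (Y ⨿ Y') where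
  apex := a.apex ⨿ b.apex
  left := coprod.map a.left b.left
  right := coprod.map a.right b.right
  mem := coprodMap_mem a.mem b.mem

namespace AdjoinOp

/-- The monoidal product and the coherence maps of `C ; Mᵒᵖ` come from the coproduct of `C`. -/
instance : MonoidalCategoryStruct (AdjoinOp M) :=
  letI tensorHom : ∀ {X₁ Y₁ X₂ Y₂ : AdjoinOp M}, (X₁ ⟶ Y₁) → (X₂ ⟶ Y₂) →
      ((of (X₁.as ⨿ X₂.as) : AdjoinOp M) ⟶ of (Y₁.as ⨿ Y₂.as)) := fun f g =>
    Quotient.map₂ (fun a b => a.sum b)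
      (by
        rintro a a' ⟨n, h₁, h₂⟩ b b' ⟨k, h₃, h₄⟩
        exact ⟨coprod.mapIso n k, by simp [MCospan.sum, h₁, h₃], by simp [MCospan.sum, h₂, h₄]⟩)
      f g
  { tensorObj := fun X Y => of (X.as ⨿ Y.as)
    tensorHom := tensorHom
    whiskerLeft := fun X _ _ f => tensorHom (𝟙 X) f
    whiskerRight := fun f Y => tensorHom f (𝟙 Y)
    tensorUnit := of (⊥_ C)
    associator := fun X Y Z => (incl M).mapIso (coprod.associator X.as Y.as Z.as)
    leftUnitor := fun X => (incl M).mapIso (coprod.leftUnitor X.as)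
    rightUnitor := fun X => (incl M).mapIso (coprod.rightUnitor X.as) }

open MonoidalCategory

theorem mk_tensorHom_mk {X₁ Y₁ X₂ Y₂ : AdjoinOp M} (a : MCospan M X₁.as Y₁.as)
    (b : MCospan M X₂.as Y₂.as) :
    (mk a : X₁ ⟶ Y₁) ⊗ₘ (mk b : X₂ ⟶ Y₂) = mk (a.sum b) := rfl

theorem incl_map_tensorHom {X₁ Y₁ X₂ Y₂ : C} (f : X₁ ⟶ Y₁) (g : X₂ ⟶ Y₂) :
    (incl M).map f ⊗ₘ (incl M).map g = (incl M).map (coprod.map f g) :=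
  mk_eq (Iso.refl _) (Category.comp_id _) ((Category.comp_id _).trans coprod.map_id_id)

theorem id_tensorHom_incl_map (X : C) {X₂ Y₂ : C} (g : X₂ ⟶ Y₂) :
    𝟙 (of X : AdjoinOp M) ⊗ₘ (incl M).map g = (incl M).map (coprod.map (𝟙 X) g) :=
  incl_map_tensorHom (𝟙 X) g

theorem incl_map_tensorHom_id {X₁ Y₁ : C} (f : X₁ ⟶ Y₁) (X : C) :
    (incl M).map f ⊗ₘ 𝟙 (of X : AdjoinOp M) = (incl M).map (coprod.map f (𝟙 X)) :=
  incl_map_tensorHom f (𝟙 X)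

/-- Naturality of isomorphisms of `C` with respect to cospans. -/
theorem mk_comp_incl_map_iso {X Y X' Y' : C} (a : MCospan M X Y) (b : MCospan M X' Y')
    (x : X ≅ X') (y : Y ≅ Y') (n : a.apex ≅ b.apex) (h₁ : a.left ≫ n.hom = x.hom ≫ b.left)
    (h₂ : a.right ≫ n.hom = y.hom ≫ b.right) :
    (mk a : of X ⟶ of Y) ≫ (incl M).map y.hom = (incl M).map x.hom ≫ (mk b : of X' ⟶ of Y') := by
  rw [mk_comp_incl_map a y.hom n.hom b.right (IsPushout.of_vert_isIso ⟨h₂⟩), incl_map_comp_mk]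
  exact mk_eq (Iso.refl _) (by simp [h₁]) (by simp)

instance : MonoidalCategory (AdjoinOp M) :=
  .ofTensorHom
    (id_tensorHom_id := fun X Y => by
      exact (incl_map_tensorHom (𝟙 X.as) (𝟙 Y.as)).trans (by simp; rfl))
    (id_tensorHom := fun _ _ _ _ => rfl)
    (tensorHom_id := fun _ _ => rfl)
    (tensorHom_comp_tensorHom := fun f₁ f₂ g₁ g₂ => by
      induction f₁ using ind with | h a₁
      induction f₂ using ind with | h a₂
      induction g₁ using ind with | h b₁
      induction g₂ using ind with | h b₂
      have h₁ := IsPushout.of_hasPushout a₁.right b₁.left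
      have h₂ := IsPushout.of_hasPushout a₂.right b₂.left
      rw [mk_tensorHom_mk, mk_tensorHom_mk, mk_comp_mk a₁ b₁ h₁, mk_comp_mk a₂ b₂ h₂,
        mk_tensorHom_mk]
      refine (mk_comp_mk (X := of _) (Y := of _) (Z := of _) (a₁.sum a₂) (b₁.sum b₂)
        (isPushout_coprodMap h₁ h₂)).trans ?_
      exact mk_eq (Iso.refl _) ((Category.comp_id _).trans (coprod.map_map _ _ _ _))
        ((Category.comp_id _).trans (coprod.map_map _ _ _ _)))
    (associator_naturality := fun f₁ f₂ f₃ => by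
      induction f₁ using ind with | h a₁
      induction f₂ using ind with | h a₂
      induction f₃ using ind with | h a₃
      exact mk_comp_incl_map_iso ((a₁.sum a₂).sum a₃) (a₁.sum (a₂.sum a₃))
        (coprod.associator _ _ _) (coprod.associator _ _ _) (coprod.associator _ _ _)
        (coprod.associator_naturality _ _ _) (coprod.associator_naturality _ _ _))
    (leftUnitor_naturality := fun f => by
      induction f using ind with | h a
      exact mk_comp_incl_map_iso (MCospan.sum ⟨_, 𝟙 _, 𝟙 _, M.id_mem _⟩ a) a
        (coprod.leftUnitor _) (coprod.leftUnitor _) (coprod.leftUnitor _)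
        (coprod.leftUnitor_naturality _) (coprod.leftUnitor_naturality _))
    (rightUnitor_naturality := fun f => by
      induction f using ind with | h a
      exact mk_comp_incl_map_iso (MCospan.sum a ⟨_, 𝟙 _, 𝟙 _, M.id_mem _⟩) a
        (coprod.rightUnitor _) (coprod.rightUnitor _) (coprod.rightUnitor _)
        (coprod.rightUnitor_naturality _) (coprod.rightUnitor_naturality _))
    (pentagon := fun W X Y Z => by
      have := congrArg (incl M).map (coprod.pentagon W.as X.as Y.as Z.as)
      simp only [Functor.map_comp, ← incl_map_tensorHom_id, ← id_tensorHom_incl_map] at this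
      exact this)
    (triangle := fun X Y => by
      have := congrArg (incl M).map (coprod.triangle X.as Y.as)
      simp only [Functor.map_comp, ← incl_map_tensorHom_id, ← id_tensorHom_incl_map] at this
      exact this)

end AdjoinOp

end

/-! ### Lax monoidal functors and decorations -/

section

open MonoidalCategory

theorem map_map_apply {D : Type*} [Category* D] (G : D ⥤ Type w) {X Y Z : D} (f : X ⟶ Y)
    (g : Y ⟶ Z) (x : G.obj X) : G.map g (G.map f x) = G.map (f ≫ g) x := by simp

variable {D : Type*} [Category* D] [MonoidalCategory D]

theorem associativity_aux (X Y Z : D) :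
    𝟙 (X ⊗ Y) ▷ Z ≫ 𝟙 _ ≫ (α_ X Y Z).hom = (α_ X Y Z).hom ≫ X ◁ 𝟙 (Y ⊗ Z) ≫ 𝟙 _ := by
  simp

theorem left_unitality_aux (X : D) : (λ_ X).hom = 𝟙 (𝟙_ D) ▷ X ≫ 𝟙 _ ≫ (λ_ X).hom := by simp

theorem right_unitality_aux (X : D) : (ρ_ X).hom = X ◁ 𝟙 (𝟙_ D) ≫ 𝟙 _ ≫ (ρ_ X).hom := by simp

end

section

open MonoidalCategory

variable {C : Type u} [Category.{v} C] [HasFiniteColimits C]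

/-- Lax monoidal structures on a functor out of `(C, +)`, where `+` is the coproduct. -/
abbrev SumLaxMonoidal {D : Type*} [Category* D] [MonoidalCategory D] (G : C ⥤ D) :=
  @Functor.LaxMonoidal C _ (monoidalOfHasFiniteCoproducts C) D _ _ G

/-- The inclusion `(C, +) ⥤ (C ; Mᵒᵖ, +)` is (strictly) monoidal. -/
instance AdjoinOp.inclLaxMonoidal (M : MorphismProperty C) [M.IsMultiplicative]
    [M.IsStableUnderCobaseChange] : SumLaxMonoidal (AdjoinOp.incl M) :=
  letI := monoidalOfHasFiniteCoproducts C
  { ε := 𝟙 (𝟙_ (AdjoinOp M))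
    μ := fun X Y => 𝟙 (AdjoinOp.of X ⊗ AdjoinOp.of Y)
    μ_natural_left := fun f X => (Category.comp_id _).trans
      ((AdjoinOp.incl_map_tensorHom_id f X).trans (Category.id_comp _).symm)
    μ_natural_right := fun X f => (Category.comp_id _).trans
      ((AdjoinOp.id_tensorHom_incl_map X f).trans (Category.id_comp _).symm)
    associativity := fun X Y Z =>
      associativity_aux (AdjoinOp.of X) (AdjoinOp.of Y) (AdjoinOp.of Z)
    left_unitality := fun X => left_unitality_aux (AdjoinOp.of X)
    right_unitality := fun X => right_unitality_aux (AdjoinOp.of X) }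

/-- The restriction to `C` of a lax monoidal functor on `C ; Mᵒᵖ` is lax monoidal. -/
instance restrictLaxMonoidal {M : MorphismProperty C} [M.IsMultiplicative]
    [M.IsStableUnderCobaseChange] (F : AdjoinOp M ⥤ Type w) [F.LaxMonoidal] :
    SumLaxMonoidal (AdjoinOp.incl M ⋙ F) :=
  letI := monoidalOfHasFiniteCoproducts C
  Functor.LaxMonoidal.comp (AdjoinOp.incl M) F

variable (G : C ⥤ Type w) [SumLaxMonoidal G]

/-- The map `φ : G N × G K → G (N + K)` of a lax monoidal functor `G : (C, +) ⥤ (Set, ×)`. -/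
def laxPair {N K : C} (s : G.obj N) (t : G.obj K) : G.obj (N ⨿ K) :=
  letI := monoidalOfHasFiniteCoproducts C
  Functor.LaxMonoidal.μ G N K (s, t)

/-- The element `φ₁ : 1 → G ∅` of a lax monoidal functor `G : (C, +) ⥤ (Set, ×)`. -/
def laxUnit : G.obj (⊥_ C) :=
  letI := monoidalOfHasFiniteCoproducts C
  Functor.LaxMonoidal.ε G PUnit.unit

theorem laxPair_map {N K N' K' : C} (n : N ⟶ N') (k : K ⟶ K') (s : G.obj N) (t : G.obj K) :
    laxPair G (G.map n s) (G.map k t) = G.map (coprod.map n k) (laxPair G s t) := by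
  let _ := monoidalOfHasFiniteCoproducts C
  exact ConcreteCategory.congr_hom (Functor.LaxMonoidal.μ_natural G n k)
    ((s, t) : G.obj N × G.obj K)

end

/-! ### Decorated cospans -/

/-- A `G`-decorated cospan: a cospan `X ⟶ N ⟵ Y` with an element of `G N`. -/
structure DecCospan {C : Type u} [Category.{v} C] (G : C ⥤ Type w) (X Y : C) where
  apex : C
  left : X ⟶ apex
  right : Y ⟶ apex
  dec : G.obj apex

/-- Isomorphism of decorated cospans. -/
instance DecCospan.setoid {C : Type u} [Category.{v} C] (G : C ⥤ Type w) (X Y : C) :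
    Setoid (DecCospan G X Y) where
  r a b := ∃ n : a.apex ≅ b.apex,
    a.left ≫ n.hom = b.left ∧ a.right ≫ n.hom = b.right ∧ G.map n.hom a.dec = b.dec
  iseqv :=
    { refl := fun a => ⟨Iso.refl _, by simp, by simp, by simp⟩
      symm := by
        rintro a b ⟨n, h₁, h₂, h₃⟩
        refine ⟨n.symm, by simp [← h₁], by simp [← h₂], ?_⟩
        rw [← h₃, Iso.symm_hom, map_map_apply, n.hom_inv_id]
        simp
      trans := by
        rintro a b c ⟨n, h₁, h₂, h₃⟩ ⟨k, h₄, h₅, h₆⟩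
        exact ⟨n ≪≫ k, by simp [← h₄, ← h₁], by simp [← h₅, ← h₂], by simp [← h₆, ← h₃]⟩ }

section

variable {C : Type u} [Category.{v} C] [HasFiniteColimits C] {G : C ⥤ Type w} [SumLaxMonoidal G]

/-- The composite of two decorated cospans: the composite cospan, decorated by the image of
`φ (s, t)` under `G [j_N, j_M] : G (N + M) → G (N +_Y M)`. -/
def DecCospan.comp {X Y Z : C} (a : DecCospan G X Y) (b : DecCospan G Y Z) : DecCospan G X Z where
  apex := pushout a.right b.left
  left := a.left ≫ pushout.inl a.right b.left
  right := b.right ≫ pushout.inr a.right b.left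
  dec := G.map (coprod.desc (pushout.inl a.right b.left) (pushout.inr a.right b.left))
    (laxPair G a.dec b.dec)

variable (G) in
/-- The identity cospan with the empty decoration. -/
def DecCospan.id (X : C) : DecCospan G X X where
  apex := X
  left := 𝟙 X
  right := 𝟙 X
  dec := G.map (initial.to X) (laxUnit G)

theorem DecCospan.comp_equiv {X Y Z : C} {a a' : DecCospan G X Y} {b b' : DecCospan G Y Z}
    (ha : a ≈ a') (hb : b ≈ b') : a.comp b ≈ a'.comp b' := by
  obtain ⟨n, hn₁, hn₂, hn₃⟩ := ha
  obtain ⟨k, hk₁, hk₂, hk₃⟩ := hb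
  have h := IsPushout.of_hasPushout a.right b.left
  have h' : IsPushout a.right b.left (n.hom ≫ pushout.inl a'.right b'.left)
      (k.hom ≫ pushout.inr a'.right b'.left) :=
    (IsPushout.of_hasPushout a'.right b'.left).of_iso (Iso.refl _) n.symm k.symm (Iso.refl _)
      (by simp [← hn₂]) (by simp [← hk₁]) (by simp) (by simp)
  refine ⟨h.isoIsPushout _ _ h', ?_, ?_, ?_⟩
  · simp [DecCospan.comp, ← hn₁]
  · simp [DecCospan.comp, ← hk₂]
  · have e : coprod.desc (pushout.inl a.right b.left) (pushout.inr a.right b.left) ≫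
        (h.isoIsPushout _ _ h').hom =
        coprod.map n.hom k.hom ≫
          coprod.desc (pushout.inl a'.right b'.left) (pushout.inr a'.right b'.left) := by
      refine coprod.hom_ext ?_ ?_
      · rw [coprod.inl_desc_assoc, coprod.inl_map_assoc, coprod.inl_desc,
          IsPushout.inl_isoIsPushout_hom]
      · rw [coprod.inr_desc_assoc, coprod.inr_map_assoc, coprod.inr_desc,
          IsPushout.inr_isoIsPushout_hom]
    refine (map_map_apply G _ _ _).trans ?_
    refine (congrArg (fun f => G.map f (laxPair G a.dec b.dec)) e).trans ?_
    rw [← map_map_apply, ← laxPair_map, hn₃, hk₃]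
    rfl

end

/-- `FCospan G` has the same objects as `C`. -/
structure FCospan {C : Type u} [Category.{v} C] (G : C ⥤ Type w) where
  of ::
  as : C

/-- Morphisms are isomorphism classes of decorated cospans. -/
instance {C : Type u} [Category.{v} C] (G : C ⥤ Type w) : Quiver (FCospan G) where
  Hom X Y := Quotient (DecCospan.setoid G X.as Y.as)

/-- The class of a decorated cospan. -/
def FCospan.mk {C : Type u} [Category.{v} C] {G : C ⥤ Type w} {X Y : C} (a : DecCospan G X Y) :
    (of X : FCospan G) ⟶ of Y :=
  Quotient.mk _ a

instance {C : Type u} [Category.{v} C] [HasFiniteColimits C] (G : C ⥤ Type w)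
    [SumLaxMonoidal G] : CategoryStruct (FCospan G) where
  id X := FCospan.mk (DecCospan.id G X.as)
  comp f g := Quotient.map₂ DecCospan.comp
    (fun _ _ ha _ _ hb => DecCospan.comp_equiv ha hb) f g

/-! ### Decorated corelations -/

section

variable {C : Type u} [Category.{v} C] [HasFiniteColimits C] (E : MorphismProperty C)
  {M : MorphismProperty C} [M.IsMultiplicative] [M.IsStableUnderCobaseChange]
  (F : AdjoinOp M ⥤ Type w)

/-- An `F`-decorated corelation: a cospan `X ⟶ N ⟵ Y` whose copairing `X + Y ⟶ N` lies in `E`,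
with an element of `F N`. -/
structure DecCorel (X Y : C) extends DecCospan (AdjoinOp.incl M ⋙ F) X Y where
  mem : E (coprod.desc left right)

/-- An isomorphism of decorated corelations is an isomorphism of decorated cospans. -/
instance DecCorel.setoid (X Y : C) : Setoid (DecCorel E F X Y) :=
  (DecCospan.setoid (AdjoinOp.incl M ⋙ F) X Y).comap DecCorel.toDecCospan

variable {E F}

/-- Given an `(E, M)`-factorisation `X + Y ⟶ K ⟶ N` of the copairing of a decorated cospan
`X ⟶ N ⟵ Y`, its jointly `E`-part `X ⟶ K ⟵ Y` decorated by the restricted decoration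
`F mᵒᵖ ∘ s`. -/
def DecCospan.ePart {X Y : C} (a : DecCospan (AdjoinOp.incl M ⋙ F) X Y)
    (fac : MorphismProperty.MapFactorizationData E M (coprod.desc a.left a.right)) :
    DecCorel E F X Y where
  apex := fac.Z
  left := coprod.inl ≫ fac.i
  right := coprod.inr ≫ fac.i
  dec := F.map (AdjoinOp.opHom fac.p fac.hp) a.dec
  mem := by
    have : coprod.desc (coprod.inl ≫ fac.i) (coprod.inr ≫ fac.i) = fac.i :=
      coprod.hom_ext (coprod.inl_desc _ _) (coprod.inr_desc _ _)
    rw [this]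
    exact fac.hi

theorem DecCospan.ePart_equiv [IsFactorizationSystem E M] {X Y : C}
    {a b : DecCospan (AdjoinOp.incl M ⋙ F) X Y} (hab : a ≈ b)
    (fa : MorphismProperty.MapFactorizationData E M (coprod.desc a.left a.right))
    (fb : MorphismProperty.MapFactorizationData E M (coprod.desc b.left b.right)) :
    a.ePart fa ≈ b.ePart fb := by
  obtain ⟨n, h₁, h₂, h₃⟩ := hab
  have hn : coprod.desc a.left a.right ≫ n.hom = coprod.desc b.left b.right :=
    coprod.hom_ext (by rw [coprod.inl_desc_assoc, coprod.inl_desc, h₁])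
      (by rw [coprod.inr_desc_assoc, coprod.inr_desc, h₂])
  have sq : 𝟙 (X ⨿ Y) ≫ fb.i ≫ fb.p = (fa.i ≫ fa.p) ≫ n.hom := by
    rw [Category.id_comp, fb.fac, fa.fac, hn]
  have sq' : 𝟙 (X ⨿ Y) ≫ fa.i ≫ fa.p = (fb.i ≫ fb.p) ≫ n.inv := by
    rw [Category.id_comp, fb.fac, fa.fac, ← hn, Category.assoc, n.hom_inv_id, Category.comp_id]
  obtain ⟨s, ⟨hs₁, hs₂⟩, -⟩ := IsFactorizationSystem.existsUnique_filler fa.i fa.p fb.i fb.p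
    (𝟙 _) n.hom fa.hi fa.hp fb.hi fb.hp sq
  obtain ⟨t, ⟨ht₁, ht₂⟩, -⟩ := IsFactorizationSystem.existsUnique_filler fb.i fb.p fa.i fa.p
    (𝟙 _) n.inv fb.hi fb.hp fa.hi fa.hp sq'
  rw [Category.id_comp] at hs₁ ht₁
  have hst : s ≫ t = 𝟙 _ :=
    (IsFactorizationSystem.existsUnique_filler fa.i fa.p fa.i fa.p (𝟙 _) (𝟙 _) fa.hi fa.hp fa.hi
      fa.hp (by simp)).unique
      ⟨by rw [← Category.assoc, hs₁, ht₁, Category.id_comp],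
        by rw [Category.assoc, ← ht₂, ← Category.assoc, ← hs₂, Category.assoc, n.hom_inv_id]⟩
      ⟨by simp, by simp⟩
  have hts : t ≫ s = 𝟙 _ :=
    (IsFactorizationSystem.existsUnique_filler fb.i fb.p fb.i fb.p (𝟙 _) (𝟙 _) fb.hi fb.hp fb.hi
      fb.hp (by simp)).unique
      ⟨by rw [← Category.assoc, ht₁, hs₁, Category.id_comp],
        by rw [Category.assoc, ← hs₂, ← Category.assoc, ← ht₂, Category.assoc, n.inv_hom_id]⟩
      ⟨by simp, by simp⟩
  let σ : fa.Z ≅ fb.Z := ⟨s, t, hst, hts⟩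
  have : IsIso σ.hom := σ.isIso_hom
  have hsq : IsPushout fa.p σ.hom n.hom fb.p := IsPushout.of_vert_isIso ⟨hs₂⟩
  have key : AdjoinOp.opHom fa.p fa.hp ≫ (AdjoinOp.incl M).map σ.hom =
      (AdjoinOp.incl M).map n.hom ≫ AdjoinOp.opHom fb.p fb.hp := by
    rw [AdjoinOp.opHom, AdjoinOp.opHom, AdjoinOp.mk_comp_incl_map _ _ n.hom fb.p hsq,
      AdjoinOp.incl_map_comp_mk]
    exact AdjoinOp.mk_eq (Iso.refl _) (by simp) (by simp)
  refine ⟨σ, ?_, ?_, ?_⟩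
  · simp [DecCospan.ePart, σ, hs₁]
  · simp [DecCospan.ePart, σ, hs₁]
  · refine (map_map_apply F _ ((AdjoinOp.incl M).map σ.hom) a.dec).trans ?_
    refine (congrArg (fun f => F.map f a.dec) key).trans ?_
    refine (map_map_apply F _ _ a.dec).symm.trans ?_
    exact congrArg (F.map (AdjoinOp.opHom fb.p fb.hp)) h₃

end

/-- `FCorel E F` has the same objects as `C`. -/
structure FCorel {C : Type u} [Category.{v} C] [HasFiniteColimits C] (E : MorphismProperty C)
    {M : MorphismProperty C} [M.IsMultiplicative] [M.IsStableUnderCobaseChange]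
    (F : AdjoinOp M ⥤ Type w) where
  of ::
  as : C

section

variable {C : Type u} [Category.{v} C] [HasFiniteColimits C] {E : MorphismProperty C}
  {M : MorphismProperty C} [M.IsMultiplicative] [M.IsStableUnderCobaseChange]
  {F : AdjoinOp M ⥤ Type w}

/-- Morphisms are isomorphism classes of decorated corelations. -/
instance : Quiver (FCorel E F) where
  Hom X Y := Quotient (DecCorel.setoid E F X.as Y.as)

/-- The class of a decorated corelation. -/
def FCorel.mk {X Y : C} (a : DecCorel E F X Y) : (of X : FCorel E F) ⟶ of Y := Quotient.mk _ a

/-- The composite of decorated corelations is the jointly `E`-part, with the restricted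
decoration, of their composite as decorated cospans. The identity is the jointly `E`-part of the
identity cospan, with the restricted empty decoration. -/
instance [IsFactorizationSystem E M] [F.LaxMonoidal] : CategoryStruct (FCorel E F) where
  id X := FCorel.mk ((DecCospan.id (AdjoinOp.incl M ⋙ F) X.as).ePart
    (MorphismProperty.factorizationData E M _))
  comp f g := Quotient.map₂
    (fun (a : DecCorel E F _ _) (b : DecCorel E F _ _) =>
      (a.toDecCospan.comp b.toDecCospan).ePart (MorphismProperty.factorizationData E M _))
    (fun _ _ ha _ _ hb => DecCospan.ePart_equiv (DecCospan.comp_equiv ha hb) _ _) f g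

end

/-! ### Category laws -/

/-- The composition and the identities of `D` satisfy the axioms of a category. -/
class CategoryLaws (D : Type*) [CategoryStruct D] : Prop where
  id_comp {X Y : D} (f : X ⟶ Y) : 𝟙 X ≫ f = f
  comp_id {X Y : D} (f : X ⟶ Y) : f ≫ 𝟙 Y = f
  assoc {W X Y Z : D} (f : W ⟶ X) (g : X ⟶ Y) (h : Y ⟶ Z) : (f ≫ g) ≫ h = f ≫ g ≫ h

/-- The resulting category, with the given composition and identities. -/
abbrev CategoryLaws.category {D : Type*} [CategoryStruct D] (h : CategoryLaws D) : Category D where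
  id_comp := h.id_comp
  comp_id := h.comp_id
  assoc := h.assoc

instance {C : Type u} [Category.{v} C] [HasFiniteColimits C] (G : C ⥤ Type w) [SumLaxMonoidal G]
    [h : CategoryLaws (FCospan G)] : Category (FCospan G) :=
  h.category

instance {C : Type u} [Category.{v} C] [HasFiniteColimits C] (E : MorphismProperty C)
    {M : MorphismProperty C} [M.IsMultiplicative] [M.IsStableUnderCobaseChange]
    [IsFactorizationSystem E M] (F : AdjoinOp M ⥤ Type w) [F.LaxMonoidal]
    [h : CategoryLaws (FCorel E F)] : Category (FCorel E F) :=
  h.category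

end

end DecoratedCorelations

open DecoratedCorelations

namespace DecoratedCorelations

noncomputable section

/-! ### Elementwise coherence of lax monoidal functors -/

section

variable {C : Type u} [Category.{v} C] [HasFiniteColimits C] (G : C ⥤ Type w) [SumLaxMonoidal G]

/-! Decorated cospans form a category because pushouts satisfy the unit and associativity laws up to
isomorphism and the maps `φ` are coherent. Once both bracketings are computed on one common apex,
each law reduces to an equation between decorations, which follows from a coherence axiom of `φ` and
an identity between maps out of coproducts.

The laws for corelations are not proved directly but carried over along the map taking a cospan to
its jointly `E`-part. This map hits every corelation (`FCospan.toCorel_surjective`), since a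
corelation is its own jointly `E`-part, so it is enough that it respects identities and composition.
The identity case is the definition. Composition amounts to this: taking jointly `E`-parts before
composing does not change the jointly `E`-part of the composite.

The relation `DecCospan.IsRestriction` isolates the reason. A jointly `E`-part is a restriction of
its cospan. Restrictions are preserved by composition (`DecCospan.IsRestriction.comp`): if `m` and
`n` lie in `M`, the induced map `q` of pushouts is a pushout of `m + n`, hence lies in `M`; the
Beck–Chevalley identity in `C ; Mᵒᵖ` and the naturality of `φ` for `mᵒᵖ` and `nᵒᵖ` then match the
decorations. Finally, a restriction has the same jointly `E`-part
(`DecCospan.IsRestriction.ePart_equiv`), by essential uniqueness of factorisations. -/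

theorem map_leftUnitor_laxPair {N : C} (s : G.obj N) :
    G.map (coprod.leftUnitor N).hom (laxPair G (laxUnit G) s) = s := by
  let _ := monoidalOfHasFiniteCoproducts C
  exact (ConcreteCategory.congr_hom (Functor.LaxMonoidal.left_unitality G N)
    ((PUnit.unit, s) : PUnit × G.obj N)).symm

theorem map_rightUnitor_laxPair {N : C} (s : G.obj N) :
    G.map (coprod.rightUnitor N).hom (laxPair G s (laxUnit G)) = s := by
  let _ := monoidalOfHasFiniteCoproducts C
  exact (ConcreteCategory.congr_hom (Functor.LaxMonoidal.right_unitality G N)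
    ((s, PUnit.unit) : G.obj N × PUnit)).symm

theorem map_associator_laxPair {N K L : C} (s : G.obj N) (t : G.obj K) (r : G.obj L) :
    G.map (coprod.associator N K L).hom (laxPair G (laxPair G s t) r) =
      laxPair G s (laxPair G t r) := by
  let _ := monoidalOfHasFiniteCoproducts C
  exact ConcreteCategory.congr_hom (Functor.LaxMonoidal.associativity G N K L)
    (((s, t), r) : (G.obj N × G.obj K) × G.obj L)

theorem laxPair_map_left {N K N' : C} (n : N ⟶ N') (s : G.obj N) (t : G.obj K) :
    laxPair G (G.map n s) t = G.map (coprod.map n (𝟙 K)) (laxPair G s t) := by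
  rw [← laxPair_map, G.map_id]
  rfl

theorem laxPair_map_right {N K K' : C} (k : K ⟶ K') (s : G.obj N) (t : G.obj K) :
    laxPair G s (G.map k t) = G.map (coprod.map (𝟙 N) k) (laxPair G s t) := by
  rw [← laxPair_map, G.map_id]
  rfl

end

/-! ### The category of decorated cospans -/

/-- Once two composites are computed on the same apex, the identity is the required isomorphism, and
only equations between legs and decorations remain. -/
theorem DecCospan.equiv_of_eq {C : Type u} [Category.{v} C] {G : C ⥤ Type w} {X Y N : C} {l l' : X ⟶ N} {r r' : Y ⟶ N} {s s' : G.obj N}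
    (h₁ : l = l') (h₂ : r = r') (h₃ : s = s') :
    (⟨N, l, r, s⟩ : DecCospan G X Y) ≈ ⟨N, l', r', s'⟩ := by
  subst h₁ h₂ h₃
  exact Setoid.refl _

section

variable {C : Type u} [Category.{v} C] [HasFiniteColimits C] {G : C ⥤ Type w} [SumLaxMonoidal G]

/-- The composite of two decorated cospans, formed with a given pushout square. -/
abbrev DecCospan.compOfSquare {X Y Z : C} (a : DecCospan G X Y) (b : DecCospan G Y Z)
    {P : C} (i : a.apex ⟶ P) (j : b.apex ⟶ P) : DecCospan G X Z where
  apex := P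
  left := a.left ≫ i
  right := b.right ≫ j
  dec := G.map (coprod.desc i j) (laxPair G a.dec b.dec)

/-- Composites may be computed with any pushout square. -/
theorem DecCospan.comp_equiv_compOfSquare {X Y Z : C} (a : DecCospan G X Y)
    (b : DecCospan G Y Z) {P : C} {i : a.apex ⟶ P} {j : b.apex ⟶ P}
    (h : IsPushout a.right b.left i j) : a.comp b ≈ a.compOfSquare b i j := by
  have h₀ := IsPushout.of_hasPushout a.right b.left
  refine ⟨h₀.isoIsPushout _ _ h, ?_, ?_, ?_⟩
  · simp [DecCospan.comp]
  · simp [DecCospan.comp]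
  · refine (map_map_apply G _ _ _).trans ?_
    refine congrArg (fun f => G.map f (laxPair G a.dec b.dec)) ?_
    refine (coprod.desc_comp _ _ _).trans ?_
    exact congrArg₂ coprod.desc (h₀.inl_isoIsPushout_hom _ _ h)
      (h₀.inr_isoIsPushout_hom _ _ h)

/-- A pushout of an identity can be taken to have apex `a.apex`. The decoration is then the left
unit law of `φ`, as `! + 1` followed by `[a.left, 1]` is the left unitor. -/
theorem DecCospan.id_comp_equiv {X Y : C} (a : DecCospan G X Y) :
    (DecCospan.id G X).comp a ≈ a := by
  refine Setoid.trans (comp_equiv_compOfSquare _ a (IsPushout.of_id_fst (f := a.left))) ?_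
  refine equiv_of_eq (Category.id_comp _) (Category.comp_id _) ?_
  refine (congrArg (G.map _) (laxPair_map_left G _ _ _)).trans ?_
  refine (map_map_apply G _ _ _).trans (Eq.trans ?_ (map_leftUnitor_laxPair G a.dec))
  refine congrArg (fun f => G.map f (laxPair G (laxUnit G) a.dec)) ?_
  -- On the initial summand there is nothing to check, so the leg `a.left` plays no role.
  refine coprod.hom_ext (initialIsInitial.hom_ext _ _) ?_
  refine (coprod.inr_map_assoc _ _ _).trans ?_
  exact (Category.id_comp _).trans ((coprod.inr_desc _ _).trans (coprod.inr_desc _ _).symm)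

theorem DecCospan.comp_id_equiv {X Y : C} (a : DecCospan G X Y) :
    a.comp (DecCospan.id G Y) ≈ a := by
  refine Setoid.trans (comp_equiv_compOfSquare a _ (IsPushout.of_id_snd (f := a.right))) ?_
  refine equiv_of_eq (Category.comp_id _) (Category.id_comp _) ?_
  refine (congrArg (G.map _) (laxPair_map_right G _ _ _)).trans ?_
  refine (map_map_apply G _ _ _).trans (Eq.trans ?_ (map_rightUnitor_laxPair G a.dec))
  refine congrArg (fun f => G.map f (laxPair G a.dec (laxUnit G))) ?_
  refine coprod.hom_ext ?_ (initialIsInitial.hom_ext _ _)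
  refine (coprod.inl_map_assoc _ _ _).trans ?_
  exact (Category.id_comp _).trans ((coprod.inl_desc _ _).trans (coprod.inl_desc _ _).symm)

/-- These are the two maps from `N + K + L` to the iterated pushout along which the two bracketings
are decorated. They visibly agree on `N` and `L`; on `K` this is `w`. -/
theorem coprodMap_desc_comp_desc {N K L P Q R : C} (i : N ⟶ P) {j : K ⟶ P} {k : K ⟶ Q}
    (l : L ⟶ Q) (p : P ⟶ R) (q : Q ⟶ R) (w : j ≫ p = k ≫ q) :
    coprod.map (coprod.desc i j) (𝟙 L) ≫ coprod.desc p (l ≫ q) =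
      (coprod.associator N K L).hom ≫ coprod.map (𝟙 N) (coprod.desc k l) ≫
        coprod.desc (i ≫ p) q := by
  rw [coprod.map_desc, coprod.map_desc, coprod.desc_comp, coprod.desc_comp, Category.id_comp,
    Category.id_comp, coprod.associator_hom, coprod.desc_comp, coprod.desc_comp, Category.assoc,
    coprod.inl_desc, Category.assoc, coprod.inr_desc, coprod.inr_desc, coprod.inl_desc, w]

theorem DecCospan.assoc_equiv {W X Y Z : C} (a : DecCospan G W X) (b : DecCospan G X Y)
    (c : DecCospan G Y Z) : (a.comp b).comp c ≈ a.comp (b.comp c) := by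
  have h₁ := IsPushout.of_hasPushout a.right b.left
  have h₂ := IsPushout.of_hasPushout b.right c.left
  -- Gluing the two binary pushouts along the middle apex gives one object which, by pasting, is an
  -- apex for both bracketings.
  have h₃ := IsPushout.of_hasPushout (pushout.inr a.right b.left) (pushout.inl b.right c.left)
  refine Setoid.trans (comp_equiv_compOfSquare (a.comp b) c (h₂.paste_horiz h₃))
    (Setoid.trans ?_
      (Setoid.symm (comp_equiv_compOfSquare a (b.comp c) (h₁.paste_vert h₃))))
  refine equiv_of_eq (Category.assoc _ _ _) (Category.assoc _ _ _).symm ?_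
  refine (congrArg (G.map _) (laxPair_map_left G _ _ _)).trans
    (Eq.trans ?_ (congrArg (G.map _) (laxPair_map_right G _ _ _)).symm)
  refine (map_map_apply G _ _ _).trans (Eq.trans ?_ (map_map_apply G _ _ _).symm)
  rw [← map_associator_laxPair]
  refine Eq.trans ?_ (map_map_apply G _ _ _).symm
  exact congrArg (fun f => G.map f (laxPair G (laxPair G a.dec b.dec) c.dec))
    (coprodMap_desc_comp_desc _ _ _ _ h₃.w)

theorem FCospan.categoryLaws (G : C ⥤ Type w) [SumLaxMonoidal G] : CategoryLaws (FCospan G) where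
  id_comp f := Quotient.inductionOn f fun a => Quotient.sound a.id_comp_equiv
  comp_id f := Quotient.inductionOn f fun a => Quotient.sound a.comp_id_equiv
  assoc f g h := Quotient.inductionOn₃ f g h fun a b c => Quotient.sound (a.assoc_equiv b c)

end

/-! ### Restriction of decorated cospans along morphisms in `M` -/

section

variable {C : Type u} [Category.{v} C] [HasFiniteColimits C] {E M : MorphismProperty C}
  [M.IsMultiplicative] [M.IsStableUnderCobaseChange] {F : AdjoinOp M ⥤ Type w}

namespace AdjoinOp

theorem opHom_comp_opHom {K N L : C} (m : K ⟶ N) (hm : M m) (n : L ⟶ K) (hn : M n) :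
    opHom m hm ≫ opHom n hn = opHom (n ≫ m) (M.comp_mem _ _ hn hm) := by
  refine (mk_comp_mk (X := of N) (Y := of K) (Z := of L) _ _
    (IsPushout.of_id_snd (f := m))).trans ?_
  exact mk_eq (Iso.refl _) (by simp [MCospan.compOfIsPushout])
    (by simp [MCospan.compOfIsPushout])

/-- The Beck–Chevalley condition for pushout squares. -/
theorem incl_map_comp_opHom {A B A' P : C} {m : A ⟶ B} {g : A ⟶ A'} {i : B ⟶ P} {j : A' ⟶ P}
    (h : IsPushout m g i j) (hm : M m) (hj : M j) :
    (incl M).map i ≫ opHom j hj = opHom m hm ≫ (incl M).map g := by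
  rw [opHom, opHom, mk_comp_incl_map _ _ i j h, incl_map_comp_mk]
  exact mk_eq (Iso.refl _) (by simp) (by simp)

open MonoidalCategory in
theorem opHom_tensorHom_opHom {K N K' N' : C} (m : K ⟶ N) (hm : M m) (n : K' ⟶ N') (hn : M n) :
    opHom m hm ⊗ₘ opHom n hn = opHom (coprod.map m n) (coprodMap_mem hm hn) :=
  mk_eq (Iso.refl _) ((Category.comp_id _).trans coprod.map_id_id) (Category.comp_id _)

end AdjoinOp

open MonoidalCategory in
-- The inclusion of `C` has identity structure maps, so restricting `F` leaves `φ` unchanged. This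
-- gives access to the naturality of `μ` for all of `C ; Mᵒᵖ`, not only for morphisms of `C`.
theorem laxPair_incl_comp [F.LaxMonoidal] {N K : C} (s : F.obj (.of N)) (t : F.obj (.of K)) :
    laxPair (AdjoinOp.incl M ⋙ F) s t =
      Functor.LaxMonoidal.μ F (.of N) (.of K) (s, t) := by
  change F.map (𝟙 _) (Functor.LaxMonoidal.μ F (.of N) (.of K) (s, t)) = _
  rw [F.map_id]
  rfl

/-- The lax structure map is natural for restriction along morphisms in `M`. -/
theorem laxPair_map_opHom [F.LaxMonoidal] {K N K' N' : C} (m : K ⟶ N) (hm : M m) (n : K' ⟶ N')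
    (hn : M n) (s : F.obj (.of N)) (t : F.obj (.of N')) :
    laxPair (AdjoinOp.incl M ⋙ F) (F.map (AdjoinOp.opHom m hm) s)
        (F.map (AdjoinOp.opHom n hn) t) =
      F.map (AdjoinOp.opHom (coprod.map m n) (coprodMap_mem hm hn))
        (laxPair (AdjoinOp.incl M ⋙ F) s t) := by
  rw [laxPair_incl_comp, laxPair_incl_comp, ← AdjoinOp.opHom_tensorHom_opHom]
  exact ConcreteCategory.congr_hom
    (Functor.LaxMonoidal.μ_natural F (AdjoinOp.opHom m hm) (AdjoinOp.opHom n hn))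
    ((s, t) : F.obj (.of N) × F.obj (.of N'))

/-- A decorated cospan `a` is a restriction of `b` if the legs of `b` factor through those of `a`
by a morphism in `M`, along which the decoration of `b` restricts to that of `a`. -/
def DecCospan.IsRestriction {X Y : C} (a b : DecCospan (AdjoinOp.incl M ⋙ F) X Y) : Prop :=
  ∃ (m : a.apex ⟶ b.apex) (hm : M m), a.left ≫ m = b.left ∧ a.right ≫ m = b.right ∧
    F.map (AdjoinOp.opHom m hm) b.dec = a.dec

theorem DecCospan.isRestriction_ePart {X Y : C} (a : DecCospan (AdjoinOp.incl M ⋙ F) X Y)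
    (fac : MorphismProperty.MapFactorizationData E M (coprod.desc a.left a.right)) :
    (a.ePart fac).toDecCospan.IsRestriction a :=
  ⟨fac.p, fac.hp,
    (Category.assoc _ _ _).trans ((congrArg _ fac.fac).trans (coprod.inl_desc _ _)),
    (Category.assoc _ _ _).trans ((congrArg _ fac.fac).trans (coprod.inr_desc _ _)), rfl⟩

/-- A commutative square of spans over the same object induces a pushout square from the
coproducts to the pushouts. -/
theorem isPushout_coprodDesc {Y N K N' K' P P' : C} {f : Y ⟶ N} {g : Y ⟶ K} {m : N ⟶ N'}
    {k : K ⟶ K'} {i : N ⟶ P} {j : K ⟶ P} (h : IsPushout f g i j) {i' : N' ⟶ P'} {j' : K' ⟶ P'}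
    (h' : IsPushout (f ≫ m) (g ≫ k) i' j') {q : P ⟶ P'} (hi : i ≫ q = m ≫ i')
    (hj : j ≫ q = k ≫ j') :
    IsPushout (coprod.map m k) (coprod.desc i j) (coprod.desc i' j') q := by
  refine isPushout_of_exists ?_ (fun T x y e => ?_) (fun T p r h₁ h₂ => ?_)
  · rw [coprod.map_desc, coprod.desc_comp, hi, hj]
  · have e₁ := coprod.inl ≫= e
    have e₂ := coprod.inr ≫= e
    rw [coprod.inl_map_assoc, coprod.inl_desc_assoc] at e₁
    rw [coprod.inr_map_assoc, coprod.inr_desc_assoc] at e₂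
    -- The two components of `x` agree on `Y` because both factor there through `y` on the pushout
    -- `P`. Hence they descend to `P'`.
    have w : (f ≫ m) ≫ coprod.inl ≫ x = (g ≫ k) ≫ coprod.inr ≫ x := by
      rw [Category.assoc, Category.assoc, e₁, e₂, h.w_assoc]
    refine ⟨h'.desc _ _ w, coprod.hom_ext ?_ ?_, h.hom_ext ?_ ?_⟩
    · rw [coprod.inl_desc_assoc, IsPushout.inl_desc]
    · rw [coprod.inr_desc_assoc, IsPushout.inr_desc]
    · rw [reassoc_of% hi, IsPushout.inl_desc, e₁]
    · rw [reassoc_of% hj, IsPushout.inr_desc, e₂]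
  · have a₁ := coprod.inl ≫= h₁
    have a₂ := coprod.inr ≫= h₁
    rw [coprod.inl_desc_assoc, coprod.inl_desc_assoc] at a₁
    rw [coprod.inr_desc_assoc, coprod.inr_desc_assoc] at a₂
    exact h'.hom_ext a₁ a₂

/-- Composition of decorated cospans preserves restrictions. -/
theorem DecCospan.IsRestriction.comp [F.LaxMonoidal] {X Y Z : C}
    {a a' : DecCospan (AdjoinOp.incl M ⋙ F) X Y} {b b' : DecCospan (AdjoinOp.incl M ⋙ F) Y Z}
    (ha : a.IsRestriction a') (hb : b.IsRestriction b') :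
    (a.comp b).IsRestriction (a'.comp b') := by
  obtain ⟨m, hm, hm₁, hm₂, hm₃⟩ := ha
  obtain ⟨n, hn, hn₁, hn₂, hn₃⟩ := hb
  have h := IsPushout.of_hasPushout a.right b.left
  have h' := IsPushout.of_hasPushout a'.right b'.left
  have w : a.right ≫ m ≫ pushout.inl a'.right b'.left =
      b.left ≫ n ≫ pushout.inr a'.right b'.left := by
    rw [reassoc_of% hm₂, reassoc_of% hn₁, pushout.condition]
  have hq := isPushout_coprodDesc (m := m) (k := n) h (hm₂.symm ▸ hn₁.symm ▸ h')
    (h.inl_desc _ _ w) (h.inr_desc _ _ w)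
  -- The comparison map of apexes is a cobase change of `m + n`; stability of `M` under pushout is
  -- essential here.
  have hM := MorphismProperty.of_isPushout hq.flip (coprodMap_mem hm hn)
  refine ⟨h.desc _ _ w, hM, ?_, ?_, ?_⟩
  · refine (Category.assoc _ _ _).trans ((a.left ≫= h.inl_desc _ _ w).trans ?_)
    exact (Category.assoc _ _ _).symm.trans (hm₁ =≫ _)
  · refine (Category.assoc _ _ _).trans ((b.right ≫= h.inr_desc _ _ w).trans ?_)
    exact (Category.assoc _ _ _).symm.trans (hn₂ =≫ _)
  · refine (map_map_apply F _ _ _).trans ?_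
    -- Beck–Chevalley: pushing forward to the large apex and then restricting equals restricting
    -- along `m + n` and then pushing forward.
    refine (congrArg (fun f => F.map f (laxPair (AdjoinOp.incl M ⋙ F) a'.dec b'.dec))
      (AdjoinOp.incl_map_comp_opHom hq (coprodMap_mem hm hn) hM)).trans ?_
    refine (map_map_apply F _ _ _).symm.trans ?_
    refine (congrArg (F.map _) (laxPair_map_opHom m hm n hn a'.dec b'.dec)).symm.trans ?_
    rw [hm₃, hn₃]
    rfl

/-- A decorated cospan and its restrictions have the same jointly `E`-part. -/
theorem DecCospan.IsRestriction.ePart_equiv [IsFactorizationSystem E M] {X Y : C}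
    {a b : DecCospan (AdjoinOp.incl M ⋙ F) X Y} (h : a.IsRestriction b)
    (fa : MorphismProperty.MapFactorizationData E M (coprod.desc a.left a.right))
    (fb : MorphismProperty.MapFactorizationData E M (coprod.desc b.left b.right)) :
    a.ePart fa ≈ b.ePart fb := by
  obtain ⟨m, hm, h₁, h₂, h₃⟩ := h
  -- Extending the `M`-part of `fa` by `m` factorises the copairing of `b` through the same middle
  -- object.
  let f : MorphismProperty.MapFactorizationData E M (coprod.desc b.left b.right) :=
    { Z := fa.Z
      i := fa.i
      p := fa.p ≫ m
      fac := by
        rw [← Category.assoc, fa.fac, coprod.desc_comp, h₁, h₂]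
      hi := fa.hi
      hp := M.comp_mem _ _ fa.hp hm }
  have hf : F.map (AdjoinOp.opHom fa.p fa.hp) a.dec = F.map (AdjoinOp.opHom f.p f.hp) b.dec := by
    rw [← h₃]
    exact (map_map_apply F _ _ _).trans
      (congrArg (fun g => F.map g b.dec) (AdjoinOp.opHom_comp_opHom m hm fa.p fa.hp))
  refine Setoid.trans (b := b.ePart f) ?_ (DecCospan.ePart_equiv (Setoid.refl b) f fb)
  exact DecCospan.equiv_of_eq (G := AdjoinOp.incl M ⋙ F) rfl rfl hf

/-- A decorated corelation is its own jointly `E`-part. -/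
theorem DecCorel.ePart_equiv_self [IsFactorizationSystem E M] {X Y : C} (a : DecCorel E F X Y)
    (fac : MorphismProperty.MapFactorizationData E M (coprod.desc a.left a.right)) :
    a.toDecCospan.ePart fac ≈ a := by
  -- The trivial factorisation, available because the copairing already lies in `E`.
  let f : MorphismProperty.MapFactorizationData E M (coprod.desc a.left a.right) :=
    { Z := a.apex
      i := coprod.desc a.left a.right
      p := 𝟙 _
      hi := a.mem
      hp := M.id_mem _ }
  refine Setoid.trans (DecCospan.ePart_equiv (Setoid.refl a.toDecCospan) fac f) ?_
  refine DecCospan.equiv_of_eq (G := AdjoinOp.incl M ⋙ F) (coprod.inl_desc _ _)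
    (coprod.inr_desc _ _) ?_
  exact ConcreteCategory.congr_hom (F.map_id (AdjoinOp.of a.apex)) a.dec

end

/-! ### The category of decorated corelations -/

section

variable {C : Type u} [Category.{v} C] [HasFiniteColimits C] (E : MorphismProperty C)
  {M : MorphismProperty C} [M.IsMultiplicative] [M.IsStableUnderCobaseChange]
  [IsFactorizationSystem E M] (F : AdjoinOp M ⥤ Type w)

/-- The map sending the class of a decorated cospan to the class of its jointly `E`-part. -/
def FCospan.toCorel {X Y : FCospan (AdjoinOp.incl M ⋙ F)} (f : X ⟶ Y) :
    (FCorel.of X.as : FCorel E F) ⟶ FCorel.of Y.as :=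
  Quotient.map (fun a : DecCospan (AdjoinOp.incl M ⋙ F) X.as Y.as =>
    a.ePart (MorphismProperty.factorizationData E M (coprod.desc a.left a.right)))
    (fun _ _ h => DecCospan.ePart_equiv h _ _) f

theorem FCospan.toCorel_mk {X Y : C} (a : DecCospan (AdjoinOp.incl M ⋙ F) X Y)
    (fac : MorphismProperty.MapFactorizationData E M (coprod.desc a.left a.right)) :
    FCospan.toCorel E F (FCospan.mk a) = FCorel.mk (a.ePart fac) :=
  Quotient.sound (DecCospan.ePart_equiv (Setoid.refl a) _ fac)

theorem FCospan.toCorel_surjective {X Y : C} (g : (FCorel.of X : FCorel E F) ⟶ FCorel.of Y) :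
    ∃ f : (FCospan.of X : FCospan (AdjoinOp.incl M ⋙ F)) ⟶ FCospan.of Y,
      FCospan.toCorel E F f = g :=
  Quotient.inductionOn g fun a =>
    ⟨FCospan.mk a.toDecCospan, Quotient.sound (a.ePart_equiv_self _)⟩

variable [F.LaxMonoidal]

theorem FCospan.toCorel_id (X : C) :
    FCospan.toCorel E F (𝟙 (FCospan.of X : FCospan (AdjoinOp.incl M ⋙ F))) =
      𝟙 (FCorel.of X : FCorel E F) :=
  rfl

/-- The composite of the jointly `E`-parts is a restriction of the composite of `a` and `b`, so both
have the same jointly `E`-part. -/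
theorem FCospan.toCorel_comp {X Y Z : FCospan (AdjoinOp.incl M ⋙ F)} (f : X ⟶ Y) (g : Y ⟶ Z) :
    FCospan.toCorel E F (f ≫ g) = FCospan.toCorel E F f ≫ FCospan.toCorel E F g :=
  Quotient.inductionOn₂ f g fun a b => Eq.symm <| Quotient.sound <|
    ((a.isRestriction_ePart _).comp (b.isRestriction_ePart _)).ePart_equiv _ _

theorem FCorel.categoryLaws : CategoryLaws (FCorel E F) where
  id_comp {X Y} f := by
    obtain ⟨f, rfl⟩ := FCospan.toCorel_surjective E F f
    -- The identity corelation is by definition the image of the identity cospan.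
    refine (FCospan.toCorel_comp E F (𝟙 _) f).symm.trans ?_
    rw [(FCospan.categoryLaws _).id_comp]
  comp_id {X Y} f := by
    obtain ⟨f, rfl⟩ := FCospan.toCorel_surjective E F f
    refine (FCospan.toCorel_comp E F f (𝟙 _)).symm.trans ?_
    rw [(FCospan.categoryLaws _).comp_id]
  assoc {W X Y Z} f g h := by
    obtain ⟨f, rfl⟩ := FCospan.toCorel_surjective E F f
    obtain ⟨g, rfl⟩ := FCospan.toCorel_surjective E F g
    obtain ⟨h, rfl⟩ := FCospan.toCorel_surjective E F h
    rw [← FCospan.toCorel_comp E F f g, ← FCospan.toCorel_comp E F g h,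
      ← FCospan.toCorel_comp E F (f ≫ g) h, ← FCospan.toCorel_comp E F f (g ≫ h),
      (FCospan.categoryLaws _).assoc]

/-- The functor from decorated cospans to decorated corelations, taking jointly `E`-parts. -/
def FCospan.toCorelFunctor [CategoryLaws (FCorel E F)]
    [CategoryLaws (FCospan (AdjoinOp.incl M ⋙ F))] :
    FCospan (AdjoinOp.incl M ⋙ F) ⥤ FCorel E F where
  obj X := FCorel.of X.as
  map f := FCospan.toCorel E F f
  map_id X := FCospan.toCorel_id E F X.as
  map_comp f g := FCospan.toCorel_comp E F f g

end

end

end DecoratedCorelations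

open DecoratedCorelations
theorem mainTheorem5 {C : Type u} [Category.{v} C] [HasFiniteColimits C]
    (E M : MorphismProperty C) [M.IsMultiplicative] [M.IsStableUnderCobaseChange]
    [IsFactorizationSystem E M] (F : AdjoinOp M ⥤ Type w) [F.LaxMonoidal] :
    ∃ (_ : CategoryLaws (FCorel E F)) (_ : CategoryLaws (FCospan (AdjoinOp.incl M ⋙ F)))
      (T : FCospan (AdjoinOp.incl M ⋙ F) ⥤ FCorel E F)
      (hT : ∀ X : C, T.obj (FCospan.of X) = FCorel.of X),
      ∀ (X Y : C) (a : DecCospan (AdjoinOp.incl M ⋙ F) X Y)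
        (fac : MorphismProperty.MapFactorizationData E M (coprod.desc a.left a.right)),
        Quiver.homOfEq (T.map (FCospan.mk a)) (hT X) (hT Y) = FCorel.mk (a.ePart fac) := by
  have h₁ := FCorel.categoryLaws E F
  have h₂ := FCospan.categoryLaws (AdjoinOp.incl M ⋙ F)
  -- The equalities of objects hold definitionally, so the transport `Quiver.homOfEq` disappears.
  exact ⟨h₁, h₂, FCospan.toCorelFunctor E F, fun _ => rfl,
    fun _ _ a fac => FCospan.toCorel_mk E F a fac⟩
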